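/- Consider the recode-and-forward relay network with one source S, relays $R_1,\dots,R_L$ and one destination D over a finite field $\mathbb F_q$. Let $K,N_S,N_R\ge 0$ be integers and let $\epsilon_{SD},\epsilon_{SR_j},\epsilon_{R_jD}\in[0,1]$ be the packet erasure probabilities of the links. In stage one S broadcasts $N_S$ packets whose coefficient vectors in $\mathbb F_q^K$ are independent and uniform; each packet is erased independently at D with probability $\epsilon_{SD}$ and at $R_j$ with probability $\epsilon_{SR_j}$. In stage two each relay $R_j$, having received $m_j$ packets with coefficient matrix $C_{S\to R_j}\in\mathbb F_q^{m_j\times K}$, draws a uniform recoding matrix $G_j\in\mathbb F_q^{N_R\times m_j}$ and sends the $N_R$ packets with coefficient rows $G_jC_{S\to R_j}$ to D, each of which is erased independently with probability $\epsilon_{R_jD}$. All coefficients and erasures are independent. The decoding probability $P_R^{(L)}$ is the probability that the matrix of all coefficient rows received by D (directly from S, and from all relays) has rank $K$. With $0^0=1$ and with empty products equal to $1$ and empty sums equal to $0$, put $$\mathcal B(m,N,\epsilon)=\binom Nm(1-\epsilon)^m\epsilon^{N-m},\qquad \mathbb P(m,K)=\prod_{i=0}^{K-1}(1-q^{i-m}),$$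 $$\mathbb P_r(m,K)=\frac1{q^{m(K-r)}}\prod_{i=0}^{r-1}\frac{q^K-q^i}{q^r-q^i}\prod_{i=0}^{r-1}(1-q^{i-m})\quad(0\le r\le \min(m,K)),$$ $$\mathbb P^{(2)}\big((m_1,m_2,m_{12}),K\big)=\sum_{i=\max(0,\,K-m_1+m_{12},\,K-m_2+m_{12})}^{\min(m_{12},K)}\mathbb P_i(m_{12},K)\,\mathbb P(m_1-m_{12},K-i)\,\mathbb P(m_2-m_{12},K-i),$$ and, for $\mathbf m=(m,m_D,m_{RD})$ and $\boldsymbol\epsilon=(\tilde\epsilon_{SR},\epsilon_{SD})$ with $\tilde\epsilon_{SR}=\prod_{j=1}^L\epsilon_{SR_j}$, $$\alpha(\mathbf m,N_S,\boldsymbol\epsilon)=\binom{N_S}{m_{RD}}\binom{N_S-m_{RD}}{m-m_{RD}}\binom{N_S-m}{m_D-m_{RD}}(1-\tilde\epsilon_{SR})^m\tilde\epsilon_{SR}^{\,N_S-m}(1-\epsilon_{SD})^{m_D}\epsilon_{SD}^{\,N_S-m_D}.$$ Let $$U^{(L)}=\sum_{\mathbf m}\alpha(\mathbf m,N_S,\boldsymbol\epsilon)\sum_{m'_1,\dots,m'_L}\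 \prod_{j=1}^L\mathcal B(m'_j,N_R,\epsilon_{R_jD})\ \mathbb P^{(2)}\big((m'+m_D,\;m-m_{RD}+m_D,\;m_D),K\big),\qquad m'=\sum_{j=1}^L m'_j,$$ where the sums run over the nonnegative integers with $m,m_D\le N_S$, $m+m_D\ge K$, $\max(0,m+m_D-N_S)\le m_{RD}\le\min(m,m_D)$, $m'_j\le N_R$ and $m'\ge K-m_D$. Then for $L=1$ one has $P_R^{(1)}=U^{(1)}$; that is, writing $\epsilon_{SR}=\epsilon_{SR_1}$ and $\epsilon_{RD}=\epsilon_{R_1D}$ (so $\tilde\epsilon_{SR}=\epsilon_{SR}$), with the same summation ranges, $$P_R^{(1)}=\sum_{\mathbf m}\alpha\big(\mathbf m,N_S,(\epsilon_{SR},\epsilon_{SD})\big)\sum_{m'}\mathcal B(m',N_R,\epsilon_{RD})\,\mathbb P^{(2)}\big((m'+m_D,\;m-m_{RD}+m_D,\;m_D),K\big).$$ -/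

import Mathlib

open scoped unitInterval

noncomputable section

namespace RelayRLNC

/-! ### The random experiment -/

/-- The joint law of a finite family of independent finite-valued random variables with laws
`p i`. -/
def indep {ι : Type*} [Fintype ι] [DecidableEq ι] {α : ι → Type*} [∀ i, Fintype (α i)]
    (p : ∀ i, PMF (α i)) : PMF (∀ i, α i) :=
  PMF.ofFintype (fun f => ∏ i, p i (f i)) (by
    rw [← Fintype.prod_sum]
    refine Finset.prod_eq_one fun i _ => ?_
    rw [← tsum_fintype (L := .unconditional _)]
    exact (p i).tsum_coe)

/-- One packet sent over a link with packet erasure probability `ε`: `true` means that the packet is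
delivered (probability `1 - ε`), `false` that it is erased (probability `ε`). -/
def packet (ε : I) : PMF Bool :=
  PMF.ofFintype (fun b => ENNReal.ofReal (if b then 1 - (ε : ℝ) else ε)) (by
    rw [Fintype.sum_bool]
    simp only [if_true, Bool.false_eq_true, if_false]
    rw [← ENNReal.ofReal_add (by linarith [ε.2.2]) ε.2.1]
    simp)

/-- `N` packets sent over a link with packet erasure probability `ε`, independently erased. -/
def link (N : ℕ) (ε : I) : PMF (Fin N → Bool) :=
  indep fun _ => packet ε

/-- The index set of the packets that are delivered when the delivery pattern is `d`. -/
abbrev Delivered {N : ℕ} (d : Fin N → Bool) : Type := {i : Fin N // d i = true}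

/-- The rows of `A` that are delivered. -/
def deliveredRows {N : ℕ} {κ F : Type*} (d : Fin N → Bool) (A : Matrix (Fin N) κ F) :
    Matrix (Delivered d) κ F :=
  A.submatrix Subtype.val id

/-- The matrix of all coding coefficients collected by the destination: the source packets it
received directly, stacked over the received recoded packets of all relays. Here
* `C` holds the coefficients of the `NS` coded packets broadcast by the source,
* `dSD`, `dSR j` are the delivery patterns from the source to the destination and to relay `j`,
* `G j` is the recoding matrix of relay `j`, with one column per packet that the relay received,
* `dRD j` is the delivery pattern from relay `j` to the destination. -/
def destMatrix {F : Type*} [Field F] {L K NS NR : ℕ}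
    (C : Matrix (Fin NS) (Fin K) F) (dSD : Fin NS → Bool) (dSR : Fin L → Fin NS → Bool)
    (G : ∀ j, Matrix (Fin NR) (Delivered (dSR j)) F) (dRD : Fin L → Fin NR → Bool) :
    Matrix (Delivered dSD ⊕ (Σ j, Delivered (dRD j))) (Fin K) F :=
  Matrix.fromRows (deliveredRows dSD C)
    (Matrix.blockDiagonal' (fun j => deliveredRows (dRD j) (G j)) *
      Matrix.of (fun x : (Σ j, Delivered (dSR j)) => deliveredRows (dSR x.1) C x.2))

/-- The law of the rank of the destination's coefficient matrix in the recode-and-forward scheme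
with `L` relays. All coding and recoding coefficients are uniform on `F`, and all coefficients and
packet erasures are independent. -/
def destRank (F : Type*) [Field F] [Fintype F] (L K NS NR : ℕ)
    (εSD : I) (εSR εRD : Fin L → I) : PMF ℕ :=
  (PMF.uniformOfFintype (Matrix (Fin NS) (Fin K) F)).bind fun C =>
  (link NS εSD).bind fun dSD =>
  (indep fun j => link NS (εSR j)).bind fun dSR =>
  (indep fun j => PMF.uniformOfFintype (Matrix (Fin NR) (Delivered (dSR j)) F)).bind fun G =>
  (indep fun j => link NR (εRD j)).bind fun dRD =>
  PMF.pure (destMatrix C dSD dSR G dRD).rank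

/-- The decoding probability of the `L`-relay network: the probability that the destination's
coefficient matrix has rank `K`. -/
def decodingProb (F : Type*) [Field F] [Fintype F] (L K NS NR : ℕ)
    (εSD : I) (εSR εRD : Fin L → I) : ℝ :=
  (destRank F L K NS NR εSD εSR εRD K).toReal

/-! ### The closed-form quantities -/

/-- The binomial probability of `m` deliveries in `N` transmissions, each erased with
probability `ε`. -/
def binomPMF (m N : ℕ) (ε : ℝ) : ℝ :=
  (N.choose m : ℝ) * (1 - ε) ^ m * ε ^ (N - m)

/-- The full-rank probability `∏_{i=0}^{K-1} (1 - q^(i-m))`, with integer exponents. -/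
def probFull (q m K : ℕ) : ℝ :=
  ∏ i ∈ Finset.range K, (1 - (q : ℝ) ^ ((i : ℤ) - (m : ℤ)))

/-- The Gaussian binomial coefficient, for `r ≤ K`. -/
def gaussBinom (q K r : ℕ) : ℝ :=
  ∏ i ∈ Finset.range r, (((q : ℝ) ^ K - (q : ℝ) ^ i) / ((q : ℝ) ^ r - (q : ℝ) ^ i))

/-- The rank-`r` probability of an `m × K` matrix, for `r ≤ min m K`. -/
def probRank (q r m K : ℕ) : ℝ :=
  1 / (q : ℝ) ^ (m * (K - r)) * gaussBinom q K r *
    ∏ i ∈ Finset.range r, (1 - (q : ℝ) ^ ((i : ℤ) - (m : ℤ)))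

/-- The joint full-rank probability of an `m₁ × K` and an `m₂ × K` matrix with `m₁₂ ≤ m₁, m₂` common
rows. The summation runs from `max (0, K - m₁ + m₁₂, K - m₂ + m₁₂)` to `min (m₁₂, K)`; the
truncated subtraction of `ℕ` supplies the `0`. -/
def probTwo (q m₁ m₂ m₁₂ K : ℕ) : ℝ :=
  ∑ i ∈ Finset.Icc (max (K + m₁₂ - m₁) (K + m₁₂ - m₂)) (min m₁₂ K),
    probRank q i m₁₂ K * (probFull q (m₁ - m₁₂) (K - i) * probFull q (m₂ - m₁₂) (K - i))

/-- The joint probability of the numbers of source packets received by the (equivalent) relay (`m`),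
by the destination (`mD`), and by both (`mRD`). -/
def alpha (m mD mRD NS : ℕ) (εSR εSD : ℝ) : ℝ :=
  (NS.choose mRD : ℝ) * ((NS - mRD).choose (m - mRD) : ℝ) * ((NS - m).choose (mD - mRD) : ℝ) *
    ((1 - εSR) ^ m * εSR ^ (NS - m)) * ((1 - εSD) ^ mD * εSD ^ (NS - mD))

/-- The sum over all `(m, mD, mRD)` with `m, mD ≤ NS`, `m + mD ≥ K` and
`max (0, m + mD - NS) ≤ mRD ≤ min (m, mD)`. -/
def sumStageOne (K NS : ℕ) (f : ℕ → ℕ → ℕ → ℝ) : ℝ :=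
  ∑ m ∈ Finset.range (NS + 1), ∑ mD ∈ Finset.range (NS + 1) with K ≤ m + mD,
    ∑ mRD ∈ Finset.Icc (m + mD - NS) (min m mD), f m mD mRD

/-- The upper bound on the decoding probability of an `L`-relay network. -/
def relayBound (q L K NS NR : ℕ) (εSD : ℝ) (εSR εRD : Fin L → ℝ) : ℝ :=
  sumStageOne K NS fun m mD mRD =>
    alpha m mD mRD NS (∏ j, εSR j) εSD *
      ∑ m' ∈ Fintype.piFinset (fun _ : Fin L => Finset.range (NR + 1)) with K ≤ mD + ∑ j, m' j,
        (∏ j, binomPMF (m' j) NR (εRD j)) *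
          probTwo q ((∑ j, m' j) + mD) (m - mRD + mD) mD K

/-- The single-relay expression. -/
def singleRelaySum (q K NS NR : ℕ) (εSD εSR εRD : ℝ) : ℝ :=
  sumStageOne K NS fun m mD mRD =>
    alpha m mD mRD NS εSR εSD *
      ∑ m' ∈ Finset.range (NR + 1) with K ≤ mD + m',
        binomPMF m' NR εRD * probTwo q (m' + mD) (m - mRD + mD) mD K

end RelayRLNC

end

/-!
The destination of a single-relay network decodes iff no nonzero `x` is annihilated by all received
rows. Such an `x` annihilates the direct packets, so on it the relay acts only through the packets
it received and the destination did not. Given the erasure patterns, decoding thus means that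
`x ↦ (f x, h (g x))` is injective, where `f`, `g`, `h` (direct packets, innovative relay packets,
recoding) are independent uniform linear maps. If `f` has rank `r`, then `g` restricted to `ker f`
is uniform and injective with probability `ℙ(·, K - r)`; for any injective value of it, `h` composed
with it is again uniform on `ker f`, so the two full-rank probabilities multiply. The law of the
rank of `f` follows by counting: a map of rank `r` factors through `F ^ r` as a surjection followed
by an injection in exactly `|GL_r(F)|` ways. If `A` and `B` are the sets of source packets delivered
to the destination and to the relay, only the sizes `m = |B|`, `mD = |A|` and `mRD = |A ∩ B|`
matter, and counting the pairs `(A, B)` of given sizes produces the weights `α`.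
-/

namespace RelayRLNC

open Finset Module
open scoped BigOperators

section ClosedForms

theorem prod_pow_sub_pow {q : ℕ} (hq : q ≠ 0) (n r : ℕ) :
    ∏ j ∈ range r, ((q : ℝ) ^ n - (q : ℝ) ^ j) = (q : ℝ) ^ (n * r) * probFull q n r := by
  have hq' : (q : ℝ) ≠ 0 := Nat.cast_ne_zero.2 hq
  calc ∏ j ∈ range r, ((q : ℝ) ^ n - (q : ℝ) ^ j)
      = ∏ j ∈ range r, (q : ℝ) ^ n * (1 - (q : ℝ) ^ ((j : ℤ) - (n : ℤ))) := by
        refine prod_congr rfl fun j _ => ?_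
        rw [zpow_sub₀ hq', zpow_natCast, zpow_natCast]
        field_simp
    _ = (q : ℝ) ^ (n * r) * probFull q n r := by
        rw [prod_mul_distrib, prod_const, card_range, ← pow_mul, probFull]

theorem probFull_eq_zero {q m K : ℕ} (h : m < K) : probFull q m K = 0 :=
  prod_eq_zero (mem_range.2 h) (by simp)

theorem probFull_self_ne_zero {q : ℕ} (hq : 1 < q) (r : ℕ) : probFull q r r ≠ 0 := by
  refine prod_ne_zero_iff.2 fun i hi => sub_ne_zero.2 (ne_of_gt ?_)
  exact zpow_lt_one_of_neg₀ (by exact_mod_cast hq) (by have := mem_range.1 hi; omega)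

theorem gaussBinom_eq {q : ℕ} (hq : q ≠ 0) (K r : ℕ) :
    gaussBinom q K r =
      (q : ℝ) ^ (K * r) * probFull q K r / ((q : ℝ) ^ (r * r) * probFull q r r) := by
  rw [gaussBinom, prod_div_distrib, prod_pow_sub_pow hq, prod_pow_sub_pow hq]

theorem probRank_eq_zero {q r m K : ℕ} (h : m < r) : probRank q r m K = 0 := by
  rw [probRank, ← probFull, probFull_eq_zero h, mul_zero]

theorem probTwo_eq_zero {q m₁ m₂ m₁₂ K : ℕ} (h : m₁ < K ∨ m₂ < K) :
    probTwo q m₁ m₂ m₁₂ K = 0 := by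
  rw [probTwo, Icc_eq_empty (by omega), sum_empty]

theorem probTwo_add_add (q m₁ m₂ m₁₂ K : ℕ) :
    probTwo q (m₁ + m₁₂) (m₂ + m₁₂) m₁₂ K =
      ∑ r ∈ range (K + 1),
        probRank q r m₁₂ K * (probFull q m₁ (K - r) * probFull q m₂ (K - r)) := by
  simp only [probTwo, Nat.add_sub_cancel]
  refine sum_subset (fun r hr => ?_) fun r _ hr => ?_
  · simp only [mem_Icc, mem_range] at hr ⊢
    omega
  · obtain h | h | h : m₁₂ < r ∨ m₁ < K - r ∨ m₂ < K - r := by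
      simp only [mem_Icc, mem_range] at *
      omega
    · rw [probRank_eq_zero h, zero_mul]
    · rw [probFull_eq_zero h, zero_mul, mul_zero]
    · rw [probFull_eq_zero h, mul_zero, mul_zero]

end ClosedForms

section Uniform

variable {X Y : Type*} [Fintype X] [Fintype Y]

theorem expect_comp_of_surjective {M : Type*} [AddCommMonoid M] [Module ℚ≥0 M] [AddGroup X]
    [AddGroup Y] (φ : X →+ Y) (hφ : Function.Surjective φ) (f : Y → M) :
    𝔼 x, f (φ x) = 𝔼 y, f y := by
  have translate (y : Y) : 𝔼 x, f (φ x) = 𝔼 x, f (φ x + y) := by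
    obtain ⟨x₀, rfl⟩ := hφ y
    exact (Fintype.expect_equiv (Equiv.addRight x₀) _ _ fun x => by simp).symm
  calc 𝔼 x, f (φ x)
      = 𝔼 y : Y, 𝔼 x, f (φ x + y) := by simp only [← translate, Fintype.expect_const]
    _ = 𝔼 x, 𝔼 y, f (φ x + y) := expect_comm ..
    _ = 𝔼 _x : X, 𝔼 y, f y :=
      expect_congr rfl fun x _ => Fintype.expect_equiv (Equiv.addLeft (φ x)) _ _ fun _ => rfl
    _ = 𝔼 y, f y := Fintype.expect_const _

open scoped Classical in
/-- The probability of the event `p` under the uniform law on a finite type. -/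
noncomputable def uniformProb (p : X → Prop) : ℝ :=
  𝔼 x, if p x then 1 else 0

theorem uniformProb_eq_natCard_div (p : X → Prop) :
    uniformProb p = (Nat.card {x // p x} : ℝ) / Nat.card X := by
  classical
  rw [uniformProb, Fintype.expect_eq_sum_div_card, sum_boole, ← Fintype.card_subtype,
    Nat.card_eq_fintype_card, Nat.card_eq_fintype_card]

open scoped Classical in
theorem uniformProb_comp_of_surjective [AddGroup X] [AddGroup Y] (φ : X →+ Y)
    (hφ : Function.Surjective φ) (p : Y → Prop) :
    (uniformProb fun x => p (φ x)) = uniformProb p :=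
  expect_comp_of_surjective φ hφ fun y => if p y then (1 : ℝ) else 0

theorem uniformProb_prod (p : X × Y → Prop) :
    uniformProb p = 𝔼 x, uniformProb fun y => p (x, y) :=
  expect_product univ univ _

end Uniform

section LinearMap

noncomputable instance {R V W : Type*} [Semiring R] [AddCommMonoid V] [AddCommMonoid W] [Module R V]
    [Module R W] [Finite V] [Finite W] : Fintype (V →ₗ[R] W) :=
  @Fintype.ofFinite _ (DFunLike.finite _)

variable {R U V W : Type*} [Ring R] [AddCommGroup U] [Module R U] [AddCommGroup V] [Module R V]
  [AddCommGroup W] [Module R W]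

theorem linearIndependent_comp_basis_iff {ι : Type*} (b : Basis ι R V) (f : V →ₗ[R] W) :
    LinearIndependent R (f ∘ b) ↔ Function.Injective f := by
  rw [LinearIndependent, Finsupp.linearCombination_linear_comp, ← b.coe_repr_symm]
  exact EquivLike.injective_comp b.repr.symm f

/-- The factorizations of a linear map as a surjection onto `U` followed by an injection correspond
to the identifications of `U` with its range. -/
noncomputable def rankFactorizationEquiv (U : Type*) [AddCommGroup U] [Module R U]
    (f : V →ₗ[R] W) :
    {p : {i : U →ₗ[R] W // Function.Injective i} × {g : V →ₗ[R] U // Function.Surjective g} //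
      p.1.1 ∘ₗ p.2.1 = f} ≃ (U ≃ₗ[R] LinearMap.range f) where
  toFun p := (LinearEquiv.ofInjective p.1.1.1 p.1.1.2).trans <| LinearEquiv.ofEq _ _ <|
    (LinearMap.range_comp_of_range_eq_top _ (LinearMap.range_eq_top.2 p.1.2.2)).symm.trans
      (congrArg LinearMap.range p.2)
  invFun e := ⟨⟨⟨(LinearMap.range f).subtype ∘ₗ e, Subtype.val_injective.comp e.injective⟩,
    ⟨e.symm ∘ₗ f.rangeRestrict, e.symm.surjective.comp f.surjective_rangeRestrict⟩⟩, by ext; simp⟩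
  left_inv := by
    rintro ⟨⟨⟨i, hi⟩, ⟨g, hg⟩⟩, rfl⟩
    refine Subtype.ext (Prod.ext (Subtype.ext rfl) (Subtype.ext ?_))
    ext x
    exact (LinearEquiv.symm_apply_eq _).2 (Subtype.ext rfl)
  right_inv e := by ext; rfl

theorem injective_prod_iff (f : V →ₗ[R] U) (k : V →ₗ[R] W) :
    Function.Injective (f.prod k) ↔ Function.Injective (k.domRestrict (LinearMap.ker f)) := by
  simp only [injective_iff_map_eq_zero, LinearMap.prod_apply, Function.prod, Prod.mk_eq_zero,
    and_imp, Subtype.forall, LinearMap.mem_ker, LinearMap.domRestrict_apply, Submodule.mk_eq_zero]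

theorem natCard_finrank_range_eq_mul {F V W : Type*} [Field F] [AddCommGroup V] [Module F V]
    [Finite V] [AddCommGroup W] [Module F W] [Finite W] (U : Type*) [AddCommGroup U] [Module F U]
    [Finite U] :
    Nat.card {f : V →ₗ[F] W // finrank F (LinearMap.range f) = finrank F U} *
        Nat.card (U ≃ₗ[F] U) =
      Nat.card {i : U →ₗ[F] W // Function.Injective i} *
        Nat.card {g : V →ₗ[F] U // Function.Surjective g} := by
  classical
  have card_equiv_range (f : V →ₗ[F] W) : Nat.card (U ≃ₗ[F] LinearMap.range f) =
      if finrank F (LinearMap.range f) = finrank F U then Nat.card (U ≃ₗ[F] U) else 0 := by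
    split_ifs with h
    · let e : LinearMap.range f ≃ₗ[F] U := LinearEquiv.ofFinrankEq _ _ h
      exact Nat.card_congr ⟨fun i => i.trans e, fun i => i.trans e.symm,
        fun i => by ext; simp, fun i => by ext; simp⟩
    · have : IsEmpty (U ≃ₗ[F] LinearMap.range f) := ⟨fun e => h e.finrank_eq.symm⟩
      exact Nat.card_of_isEmpty
  symm
  rw [← Nat.card_prod, ← Nat.card_congr (Equiv.sigmaFiberEquiv fun p :
    {i : U →ₗ[F] W // Function.Injective i} × {g : V →ₗ[F] U // Function.Surjective g} =>
      p.1.1 ∘ₗ p.2.1), Nat.card_sigma]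
  simp only [Nat.card_congr (rankFactorizationEquiv U _), card_equiv_range]
  rw [← sum_filter, sum_const, smul_eq_mul, ← Fintype.card_subtype,
    ← Nat.card_eq_fintype_card]

end LinearMap

section Counting

variable {F V W : Type*} [Field F] [Fintype F] [AddCommGroup V] [Module F V] [Finite V]
  [AddCommGroup W] [Module F W] [Finite W]

local notation "q" => Fintype.card F

theorem natCard_linearMap :
    Nat.card (V →ₗ[F] W) = q ^ (finrank F W * finrank F V) := by
  rw [natCard_eq_pow_finrank (K := F), Nat.card_eq_fintype_card, finrank_linearMap, mul_comm]

theorem natCard_linearIndependent (r : ℕ) :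
    (Nat.card {s : Fin r → V // LinearIndependent F s} : ℝ) =
      (q : ℝ) ^ (finrank F V * r) * probFull q (finrank F V) r := by
  rcases le_or_gt r (finrank F V) with h | h
  · rw [card_linearIndependent h, ← prod_pow_sub_pow Fintype.card_ne_zero, prod_range,
      Nat.cast_prod]
    refine prod_congr rfl fun j _ => ?_
    rw [Nat.cast_sub (Nat.pow_le_pow_right Fintype.card_pos (j.2.le.trans h)), Nat.cast_pow,
      Nat.cast_pow]
  · have : IsEmpty {s : Fin r → V // LinearIndependent F s} :=
      ⟨fun s => h.not_ge (by simpa using s.2.fintype_card_le_finrank)⟩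
    rw [probFull_eq_zero h, Nat.card_of_isEmpty, Nat.cast_zero, mul_zero]

theorem natCard_injective_linearMap :
    (Nat.card {f : V →ₗ[F] W // Function.Injective f} : ℝ) =
      (q : ℝ) ^ (finrank F W * finrank F V) * probFull q (finrank F W) (finrank F V) := by
  let b := finBasis F V
  rw [← natCard_linearIndependent, ← Nat.card_congr ((b.constr F).symm.toEquiv.subtypeEquiv
    fun f => (linearIndependent_comp_basis_iff b f).symm)]

theorem natCard_surjective_linearMap :
    (Nat.card {f : V →ₗ[F] W // Function.Surjective f} : ℝ) =
      (q : ℝ) ^ (finrank F V * finrank F W) * probFull q (finrank F V) (finrank F W) := by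
  let transpose : (V →ₗ[F] W) ≃ₗ[F] (Dual F W →ₗ[F] Dual F V) :=
    (evalEquiv F W).congrRight.trans LinearMap.lflip
  have := Module.finite_of_finite F (M := Dual F V)
  have := Module.finite_of_finite F (M := Dual F W)
  have e : {f : V →ₗ[F] W // Function.Surjective f} ≃
      {f : Dual F W →ₗ[F] Dual F V // Function.Injective f} :=
    transpose.toEquiv.subtypeEquiv fun f => (LinearMap.dualMap_injective_iff (f := f)).symm
  rw [Nat.card_congr e, natCard_injective_linearMap, Subspace.dual_finrank_eq,
    Subspace.dual_finrank_eq]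

theorem natCard_linearEquiv (h : finrank F V = finrank F W) :
    (Nat.card (V ≃ₗ[F] W) : ℝ) =
      (q : ℝ) ^ (finrank F V * finrank F V) * probFull q (finrank F V) (finrank F V) := by
  let e : (V ≃ₗ[F] W) ≃ {f : V →ₗ[F] W // Function.Injective f} :=
    { toFun := fun e => ⟨e, e.injective⟩
      invFun := fun f => LinearEquiv.ofInjectiveOfFinrankEq f.1 f.2 h
      left_inv := fun e => by ext; rfl
      right_inv := fun f => by ext; rfl }
  rw [Nat.card_congr e, natCard_injective_linearMap, h]

theorem natCard_finrank_range_eq (r : ℕ) :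
    (Nat.card {f : V →ₗ[F] W // finrank F (LinearMap.range f) = r} : ℝ) =
      Nat.card (V →ₗ[F] W) * probRank q r (finrank F W) (finrank F V) := by
  have hq : (q : ℝ) ≠ 0 := Nat.cast_ne_zero.2 Fintype.card_ne_zero
  have hr := probFull_self_ne_zero (Fintype.one_lt_card (α := F)) r
  have h := congrArg (Nat.cast (R := ℝ))
    (natCard_finrank_range_eq_mul (F := F) (V := V) (W := W) (Fin r → F))
  rw [Nat.cast_mul, Nat.cast_mul, natCard_injective_linearMap, natCard_surjective_linearMap,
    natCard_linearEquiv rfl, finrank_fin_fun] at h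
  rw [natCard_linearMap, probRank, ← probFull, gaussBinom_eq Fintype.card_ne_zero, Nat.cast_pow]
  rcases le_or_gt r (finrank F V) with hrV | hrV
  · rw [← Nat.sub_add_cancel hrV, mul_add, pow_add, Nat.sub_add_cancel hrV]
    rw [← eq_div_iff (mul_ne_zero (pow_ne_zero _ hq) hr)] at h
    rw [h]
    field_simp
  · rw [probFull_eq_zero hrV] at h ⊢
    simpa [hq, hr] using h

theorem expect_finrank_range (c : ℕ → ℝ) :
    𝔼 f : V →ₗ[F] W, c (finrank F (LinearMap.range f)) =
      ∑ r ∈ range (finrank F V + 1), probRank q r (finrank F W) (finrank F V) * c r := by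
  classical
  have hcard : (Nat.card (V →ₗ[F] W) : ℝ) ≠ 0 := Nat.cast_ne_zero.2 Nat.card_pos.ne'
  have finrank_range_mem (f : V →ₗ[F] W) (_ : f ∈ univ) :
      finrank F (LinearMap.range f) ∈ range (finrank F V + 1) :=
    mem_range.2 (Nat.lt_succ_of_le f.finrank_range_le)
  rw [Fintype.expect_eq_sum_div_card, ← Nat.card_eq_fintype_card, div_eq_iff hcard, sum_mul,
    ← sum_fiberwise_of_maps_to finrank_range_mem]
  refine sum_congr rfl fun r _ => ?_
  rw [sum_congr rfl fun f hf => by rw [(mem_filter.1 hf).2], sum_const, nsmul_eq_mul,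
    ← Fintype.card_subtype, ← Nat.card_eq_fintype_card, natCard_finrank_range_eq]
  ring

theorem uniformProb_injective :
    (uniformProb fun f : V →ₗ[F] W => Function.Injective f) =
      probFull q (finrank F W) (finrank F V) := by
  have hcard : (Nat.card (V →ₗ[F] W) : ℝ) ≠ 0 := Nat.cast_ne_zero.2 Nat.card_pos.ne'
  rw [uniformProb_eq_natCard_div, div_eq_iff hcard, natCard_injective_linearMap,
    natCard_linearMap, Nat.cast_pow, mul_comm]

variable {A M N U : Type*} [AddCommGroup A] [Module F A] [AddCommGroup M] [Module F M] [Finite M]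
  [AddCommGroup N] [Module F N] [Finite N] [AddCommGroup U] [Module F U] [Finite U]

theorem uniformProb_injective_comp_of_injective {g : V →ₗ[F] N} (hg : Function.Injective g) :
    (uniformProb fun h : N →ₗ[F] M => Function.Injective (h ∘ₗ g)) =
      probFull q (finrank F M) (finrank F V) := by
  obtain ⟨g', hg'⟩ := g.exists_leftInverse_of_injective (LinearMap.ker_eq_bot.2 hg)
  have hsurj : Function.Surjective (LinearMap.lcomp F M g) := fun k =>
    ⟨k ∘ₗ g', by rw [LinearMap.lcomp_apply', LinearMap.comp_assoc, hg', LinearMap.comp_id]⟩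
  exact (uniformProb_comp_of_surjective (LinearMap.lcomp F M g).toAddMonoidHom hsurj _).trans
    uniformProb_injective

theorem uniformProb_injective_comp :
    (uniformProb fun p : (V →ₗ[F] N) × (N →ₗ[F] M) => Function.Injective (p.2 ∘ₗ p.1)) =
      probFull q (finrank F M) (finrank F V) * probFull q (finrank F N) (finrank F V) := by
  rw [uniformProb_prod, ← uniformProb_injective (V := V) (W := N), uniformProb, mul_expect]
  refine expect_congr rfl fun g _ => ?_
  split_ifs with hg
  · rw [mul_one, uniformProb_injective_comp_of_injective hg]
  · rw [mul_zero]
    exact expect_eq_zero fun h _ => if_neg fun hinj => hg (Function.Injective.of_comp hinj)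

theorem uniformProb_injective_prod_comp (f : U →ₗ[F] A) :
    (uniformProb fun p : (U →ₗ[F] N) × (N →ₗ[F] M) => Function.Injective (f.prod (p.2 ∘ₗ p.1))) =
      probFull q (finrank F M) (finrank F U - finrank F (LinearMap.range f)) *
        probFull q (finrank F N) (finrank F U - finrank F (LinearMap.range f)) := by
  obtain ⟨s, hs⟩ := (LinearMap.ker f).subtype.exists_leftInverse_of_injective
    (Submodule.ker_subtype _)
  have restrict_surjective :
      Function.Surjective (LinearMap.lcomp F N (LinearMap.ker f).subtype) := fun g =>
    ⟨g ∘ₗ s, by rw [LinearMap.lcomp_apply', LinearMap.comp_assoc, hs, LinearMap.comp_id]⟩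
  have finrank_ker : finrank F U - finrank F (LinearMap.range f) = finrank F (LinearMap.ker f) := by
    have := f.finrank_range_add_finrank_ker
    omega
  rw [finrank_ker, ← uniformProb_injective_comp]
  simp only [injective_prod_iff]
  exact uniformProb_comp_of_surjective
    ((LinearMap.lcomp F N (LinearMap.ker f).subtype).toAddMonoidHom.prodMap (.id (N →ₗ[F] M)))
    (restrict_surjective.prodMap Function.surjective_id) fun p => Function.Injective (p.2 ∘ₗ p.1)

theorem uniformProb_injective_prod [Finite A] :
    (uniformProb fun p : (U →ₗ[F] A) × (U →ₗ[F] N) × (N →ₗ[F] M) =>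
        Function.Injective (p.1.prod (p.2.2 ∘ₗ p.2.1))) =
      probTwo q (finrank F M + finrank F A) (finrank F N + finrank F A) (finrank F A)
        (finrank F U) := by
  rw [uniformProb_prod, probTwo_add_add, ← expect_finrank_range (V := U) (W := A) fun r =>
    probFull q (finrank F M) (finrank F U - r) * probFull q (finrank F N) (finrank F U - r)]
  exact expect_congr rfl fun f _ => uniformProb_injective_prod_comp f

end Counting

section Matrix

variable {R m n n' : Type*} [NonUnitalNonAssocSemiring R]

theorem mulVec_eq_submatrix_mulVec_comp [Fintype n] [Fintype n'] (M : Matrix m n R) {v : n → R}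
    {e : n' → n} (he : Function.Injective e) (hv : ∀ i ∉ Set.range e, v i = 0) :
    M.mulVec v = (M.submatrix id e).mulVec (v ∘ e) := by
  ext i
  exact (Fintype.sum_of_injective e he _ _ (fun k hk => by rw [hv k hk, mul_zero])
    fun _ => rfl).symm

theorem blockDiagonal'_mulVec {o : Type*} [Fintype o] [DecidableEq o] {m n : o → Type*}
    [∀ k, Fintype (n k)] (M : ∀ k, Matrix (m k) (n k) R) (v : (Σ k, n k) → R) (s : Σ k, m k) :
    (Matrix.blockDiagonal' M).mulVec v s = (M s.1).mulVec (fun i => v ⟨s.1, i⟩) s.2 := by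
  obtain ⟨k, i⟩ := s
  simp only [Matrix.mulVec, dotProduct, Fintype.sum_sigma]
  rw [Fintype.sum_eq_single k]
  · simp only [Matrix.blockDiagonal'_apply_eq]
  · intro k' hk'
    simp only [Matrix.blockDiagonal'_apply_ne _ _ _ hk'.symm, zero_mul, sum_const_zero]

theorem rank_eq_card_iff_injective {F m n : Type*} [Field F] [Fintype n] (M : Matrix m n F) :
    M.rank = Fintype.card n ↔ Function.Injective M.mulVecLin := by
  have h := M.mulVecLin.finrank_range_add_finrank_ker
  rw [finrank_fintype_fun_eq_card] at h
  rw [← LinearMap.ker_eq_bot, ← Submodule.finrank_eq_zero, Matrix.rank]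
  omega

theorem submatrix_surjective {α m n m' n' : Type*} [Nonempty α] {e : m' → m} {e' : n' → n}
    (he : Function.Injective e) (he' : Function.Injective e') :
    Function.Surjective fun M : Matrix m n α => M.submatrix e e' :=
  he'.surjective_comp_right.comp_left.comp he.surjective_comp_right

end Matrix

section Network

variable {F : Type*} [Field F] {L K NS NR : ℕ}

theorem destMatrix_mulVec_eq_zero_iff (C : Matrix (Fin NS) (Fin K) F) (a : Fin NS → Bool)
    (b : Fin L → Fin NS → Bool) (G : ∀ j, Matrix (Fin NR) (Delivered (b j)) F)
    (d : Fin L → Fin NR → Bool) (x : Fin K → F) :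
    (destMatrix C a b G d).mulVec x = 0 ↔ (deliveredRows a C).mulVec x = 0 ∧
      ∀ j, (deliveredRows (d j) (G j)).mulVec ((deliveredRows (b j) C).mulVec x) = 0 := by
  rw [destMatrix, Matrix.fromRows_mulVec, ← Matrix.mulVec_mulVec, ← Sum.elim_zero_zero,
    Sum.elim_eq_iff]
  refine and_congr_right fun _ => ?_
  simp only [funext_iff, blockDiagonal'_mulVec, Sigma.forall]
  rfl

/-- The packets delivered under the pattern `b` but not under `a`: with `a` the pattern from the
source to the destination and `b` the one to a relay, those that the relay alone can contribute. -/
def innovative {N : ℕ} (a b : Fin N → Bool) : Fin N → Bool :=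
  fun i => b i && !a i

/-- The inclusion of the innovative packets into all packets delivered under `b`. -/
def innovativeInclusion {N : ℕ} (a b : Fin N → Bool) (i : Delivered (innovative a b)) :
    Delivered b :=
  ⟨i, (Bool.and_eq_true_iff.1 i.2).1⟩

theorem innovativeInclusion_injective {N : ℕ} (a b : Fin N → Bool) :
    Function.Injective (innovativeInclusion a b) :=
  fun _ _ h => Subtype.ext (congrArg (fun i => i.1) h)

theorem mulVec_deliveredRows_eq_innovative {m : Type*} {C : Matrix (Fin NS) (Fin K) F}
    {a : Fin NS → Bool} {x : Fin K → F} (hx : (deliveredRows a C).mulVec x = 0)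
    (b : Fin NS → Bool) (M : Matrix m (Delivered b) F) :
    M.mulVec ((deliveredRows b C).mulVec x) = (M.submatrix id (innovativeInclusion a b)).mulVec
      ((deliveredRows (innovative a b) C).mulVec x) := by
  refine mulVec_eq_submatrix_mulVec_comp M (innovativeInclusion_injective a b) fun i hi => ?_
  by_cases ha : a i = true
  · exact congrFun hx ⟨i, ha⟩
  · exact absurd ⟨⟨i, by simp [innovative, i.2, ha]⟩, rfl⟩ hi

/-- The linear maps that decide whether the destination of a single-relay network can decode: the
packets received from the source, the innovative packets of the relay, and the recoding of the
latter as received by the destination. -/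
noncomputable def decodingMaps (a : Fin NS → Bool) (b : Fin 1 → Fin NS → Bool)
    (d : Fin 1 → Fin NR → Bool) :
    Matrix (Fin NS) (Fin K) F × (∀ j, Matrix (Fin NR) (Delivered (b j)) F) →+
      ((Fin K → F) →ₗ[F] (Delivered a → F)) ×
        ((Fin K → F) →ₗ[F] (Delivered (innovative a (b 0)) → F)) ×
        ((Delivered (innovative a (b 0)) → F) →ₗ[F] (Delivered (d 0) → F)) :=
  AddMonoidHom.mk' (fun p => ((deliveredRows a p.1).mulVecLin,
    (deliveredRows (innovative a (b 0)) p.1).mulVecLin,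
    ((p.2 0).submatrix Subtype.val (innovativeInclusion a (b 0))).mulVecLin)) fun p p' => by
      simp [deliveredRows, Matrix.submatrix_add, Matrix.mulVecLin_add]

theorem rank_destMatrix_eq_iff (a : Fin NS → Bool) (b : Fin 1 → Fin NS → Bool)
    (d : Fin 1 → Fin NR → Bool)
    (p : Matrix (Fin NS) (Fin K) F × ∀ j, Matrix (Fin NR) (Delivered (b j)) F) :
    (destMatrix p.1 a b p.2 d).rank = K ↔
      Function.Injective ((decodingMaps a b d p).1.prod
        ((decodingMaps a b d p).2.2 ∘ₗ (decodingMaps a b d p).2.1)) := by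
  have rank_eq_iff := rank_eq_card_iff_injective (destMatrix p.1 a b p.2 d)
  rw [Fintype.card_fin] at rank_eq_iff
  rw [rank_eq_iff, injective_iff_map_eq_zero, injective_iff_map_eq_zero]
  refine forall_congr' fun x => imp_congr_left ?_
  rw [Matrix.mulVecLin_apply, destMatrix_mulVec_eq_zero_iff, Fin.forall_fin_one,
    LinearMap.prod_apply, Function.prod, Prod.mk_eq_zero]
  refine and_congr_right fun hx => ?_
  rw [mulVec_deliveredRows_eq_innovative hx]
  rfl

theorem decodingMaps_surjective (a : Fin NS → Bool) (b : Fin 1 → Fin NS → Bool)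
    (d : Fin 1 → Fin NR → Bool) :
    Function.Surjective (decodingMaps (F := F) (K := K) a b d) := by
  rintro ⟨f, g, h⟩
  have rows_injective : Function.Injective (Sum.elim Subtype.val Subtype.val :
      Delivered a ⊕ Delivered (innovative a (b 0)) → Fin NS) := by
    refine Subtype.val_injective.sumElim Subtype.val_injective fun i i' hii' => ?_
    have := i'.2
    simp [innovative, ← hii', i.2] at this
  obtain ⟨C, hC⟩ := submatrix_surjective rows_injective Function.injective_id
    (Matrix.fromRows (LinearMap.toMatrix' f) (LinearMap.toMatrix' g))
  obtain ⟨G₀, hG₀⟩ := submatrix_surjective (m := Fin NR) Subtype.val_injective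
    (innovativeInclusion_injective a (b 0)) (LinearMap.toMatrix' h)
  obtain ⟨G, rfl⟩ := Function.surjective_eval (β := fun j => Matrix (Fin NR) (Delivered (b j)) F)
    0 G₀
  have hf : deliveredRows a C = LinearMap.toMatrix' f := congrArg Matrix.toRows₁ hC
  have hg : deliveredRows (innovative a (b 0)) C = LinearMap.toMatrix' g :=
    congrArg Matrix.toRows₂ hC
  refine ⟨(C, G), Prod.ext ?_ (Prod.ext ?_ ?_)⟩
  · exact (congrArg Matrix.toLin' hf).trans (Matrix.toLin'_toMatrix' f)
  · exact (congrArg Matrix.toLin' hg).trans (Matrix.toLin'_toMatrix' g)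
  · exact (congrArg Matrix.toLin' hG₀).trans (Matrix.toLin'_toMatrix' h)

theorem uniformProb_rank_destMatrix_eq [Fintype F] (a : Fin NS → Bool) (b : Fin 1 → Fin NS → Bool)
    (d : Fin 1 → Fin NR → Bool) :
    (uniformProb fun p : Matrix (Fin NS) (Fin K) F × (∀ j, Matrix (Fin NR) (Delivered (b j)) F) =>
        (destMatrix p.1 a b p.2 d).rank = K) =
      probTwo (Fintype.card F) (Fintype.card (Delivered (d 0)) + Fintype.card (Delivered a))
        (Fintype.card (Delivered (innovative a (b 0))) + Fintype.card (Delivered a))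
        (Fintype.card (Delivered a)) K := by
  simp only [rank_destMatrix_eq_iff]
  have decodingMaps_uniform := uniformProb_comp_of_surjective (decodingMaps (F := F) (K := K) a b d)
    (decodingMaps_surjective a b d) fun p => Function.Injective (p.1.prod (p.2.2 ∘ₗ p.2.1))
  rw [decodingMaps_uniform, uniformProb_injective_prod]
  simp only [finrank_fintype_fun_eq_card, Fintype.card_fin]

end Network

section SubsetSums

variable {ι M : Type*} [Fintype ι] [DecidableEq ι] [AddCommMonoid M]

theorem sum_inter_sdiff (B : Finset ι) (f : Finset ι → Finset ι → M) :
    ∑ A, f (A ∩ B) (A \ B) = ∑ S ∈ B.powerset, ∑ T ∈ Bᶜ.powerset, f S T := by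
  rw [← sum_product']
  refine sum_nbij' (fun A => (A ∩ B, A \ B)) (fun p => p.1 ∪ p.2) ?_ ?_ ?_ ?_ ?_
  · intro A _
    simp [inter_subset_right, sdiff_eq_inter_compl]
  · simp
  · intro A _
    exact sup_inf_sdiff A B
  · rintro ⟨S, T⟩ hST
    simp only [mem_product, mem_powerset] at hST
    ext x <;> grind [mem_compl]
  · simp

theorem sum_range_range_eq_sum_Icc {m N : ℕ} (hm : m ≤ N) (f : ℕ → ℕ → M) :
    ∑ i ∈ range (m + 1), ∑ j ∈ range (N - m + 1), f i j =
      ∑ n ∈ range (N + 1), ∑ i ∈ Icc (m + n - N) (min m n), f i (n - i) := by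
  rw [sum_sigma', sum_sigma']
  refine sum_nbij' (fun p => ⟨p.1 + p.2, p.1⟩) (fun p => ⟨p.2, p.1 - p.2⟩) ?_ ?_ ?_ ?_ ?_ <;>
    rintro ⟨i, j⟩ <;> grind

theorem sum_card_inter (B : Finset ι) (f : ℕ → ℕ → M) :
    ∑ A : Finset ι, f #A #(A ∩ B) =
      ∑ n ∈ range (Fintype.card ι + 1), ∑ i ∈ Icc (#B + n - Fintype.card ι) (min #B n),
        ((#B).choose i * (Fintype.card ι - #B).choose (n - i)) • f n i := by
  calc ∑ A : Finset ι, f #A #(A ∩ B)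
      = ∑ A, f (#(A ∩ B) + #(A \ B)) #(A ∩ B) := by simp only [card_inter_add_card_sdiff]
    _ = ∑ i ∈ range (#B + 1), ∑ j ∈ range (Fintype.card ι - #B + 1),
          ((#B).choose i * (Fintype.card ι - #B).choose j) • f (i + j) i := by
      rw [sum_inter_sdiff B fun S T => f (#S + #T) #S]
      simp only [fun i : ℕ => sum_powerset_apply_card (x := Bᶜ) fun j => f (i + j) i]
      rw [sum_powerset_apply_card fun i =>
        ∑ j ∈ range (#Bᶜ + 1), (#Bᶜ).choose j • f (i + j) i, card_compl]
      simp only [smul_sum, mul_smul]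
    _ = _ := by
      rw [sum_range_range_eq_sum_Icc (card_le_univ B)]
      refine sum_congr rfl fun n _ => sum_congr rfl fun i hi => ?_
      have := mem_Icc.1 hi
      rw [Nat.add_sub_cancel' (by omega)]

end SubsetSums

section Law

theorem toReal_bind_apply {α β : Type*} [Fintype α] (p : PMF α) (f : α → PMF β) (y : β) :
    ((p.bind f) y).toReal = ∑ x, (p x).toReal * (f x y).toReal := by
  rw [PMF.bind_apply, tsum_fintype, ENNReal.toReal_sum fun x _ =>
    ENNReal.mul_ne_top (p.apply_ne_top x) ((f x).apply_ne_top y)]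
  simp only [ENNReal.toReal_mul]

theorem sum_uniformOfFintype {α : Type*} [Fintype α] [Nonempty α] (f : α → ℝ) :
    ∑ x, (PMF.uniformOfFintype α x).toReal * f x = 𝔼 x, f x := by
  simp only [PMF.uniformOfFintype_apply, ENNReal.toReal_inv, ENNReal.toReal_natCast, ← mul_sum]
  rw [Fintype.expect_eq_sum_div_card, div_eq_inv_mul]

variable {ι : Type*} [Fintype ι] [DecidableEq ι]

theorem indep_uniformOfFintype {α : ι → Type*} [∀ i, Fintype (α i)] [∀ i, Nonempty (α i)] :
    indep (fun i => PMF.uniformOfFintype (α i)) = PMF.uniformOfFintype (∀ i, α i) := by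
  ext f
  simp only [indep, PMF.ofFintype_apply, PMF.uniformOfFintype_apply, Fintype.card_pi, Nat.cast_prod]
  exact (ENNReal.prod_inv_distrib fun i _ j _ _ => .inr (ENNReal.natCast_ne_top _)).symm

theorem toReal_indep {α : ι → Type*} [∀ i, Fintype (α i)] (p : ∀ i, PMF (α i)) (f : ∀ i, α i) :
    (indep p f).toReal = ∏ i, (p i (f i)).toReal :=
  ENNReal.toReal_prod ..

variable {F : Type*} [Field F] [Fintype F] {L K NS NR : ℕ}

theorem decodingProb_eq_sum_uniformProb (εSD : I) (εSR εRD : Fin L → I) :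
    decodingProb F L K NS NR εSD εSR εRD =
      ∑ b : Fin L → Fin NS → Bool, (∏ j, (link NS (εSR j) (b j)).toReal) *
        ∑ a, (link NS εSD a).toReal *
          ∑ d : Fin L → Fin NR → Bool, (∏ j, (link NR (εRD j) (d j)).toReal) *
            uniformProb fun p :
                Matrix (Fin NS) (Fin K) F × (∀ j, Matrix (Fin NR) (Delivered (b j)) F) =>
              (destMatrix p.1 a b p.2 d).rank = K := by
  classical
  have toReal_pure (r : ℕ) : (PMF.pure r K).toReal = if r = K then 1 else 0 := by
    simp [PMF.pure_apply, apply_ite ENNReal.toReal, eq_comm (a := K)]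
  simp only [decodingProb, destRank, toReal_bind_apply, indep_uniformOfFintype,
    sum_uniformOfFintype, toReal_indep, toReal_pure]
  simp only [uniformProb, ← univ_product_univ, expect_product, mul_expect, mul_sum, expect_sum_comm]
  rw [sum_comm]
  simp only [mul_left_comm (link NS εSD _).toReal]
  congr!

/-- The set of packets delivered under a pattern. -/
def deliveredFinset {N : ℕ} (d : Fin N → Bool) : Finset (Fin N) :=
  univ.filter fun i => d i = true

theorem deliveredFinset_bijective (N : ℕ) : Function.Bijective (deliveredFinset (N := N)) := by
  refine Function.bijective_iff_has_inverse.2 ⟨fun A i => decide (i ∈ A), fun d => ?_, fun A => ?_⟩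
  · ext i
    simp [deliveredFinset]
  · ext i
    simp [deliveredFinset]

theorem card_delivered {N : ℕ} (d : Fin N → Bool) :
    Fintype.card (Delivered d) = #(deliveredFinset d) :=
  Fintype.card_subtype _

theorem deliveredFinset_innovative {N : ℕ} (a b : Fin N → Bool) :
    deliveredFinset (innovative a b) = deliveredFinset b \ deliveredFinset a := by
  ext i
  simp [deliveredFinset, innovative]

theorem toReal_packet (ε : I) (b : Bool) :
    (packet ε b).toReal = if b = true then 1 - (ε : ℝ) else ε := by
  refine ENNReal.toReal_ofReal ?_
  split_ifs
  exacts [unitInterval.one_minus_nonneg ε, unitInterval.nonneg ε]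

theorem toReal_link {N : ℕ} (ε : I) (d : Fin N → Bool) :
    (link N ε d).toReal =
      (1 - (ε : ℝ)) ^ #(deliveredFinset d) * (ε : ℝ) ^ (N - #(deliveredFinset d)) := by
  simp only [link, toReal_indep, toReal_packet]
  rw [prod_ite, prod_const, prod_const, filter_not, ← compl_eq_univ_sdiff, card_compl,
    Fintype.card_fin, deliveredFinset]

theorem sum_link (N : ℕ) (ε : I) (f : ℕ → ℝ) :
    ∑ d, (link N ε d).toReal * f #(deliveredFinset d) =
      ∑ m ∈ range (N + 1), binomPMF m N ε * f m := by
  simp only [toReal_link]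
  rw [(deliveredFinset_bijective N).sum_comp fun A =>
    (1 - (ε : ℝ)) ^ #A * (ε : ℝ) ^ (N - #A) * f #A, ← powerset_univ,
    sum_powerset_apply_card fun m => (1 - (ε : ℝ)) ^ m * (ε : ℝ) ^ (N - m) * f m, card_univ,
    Fintype.card_fin]
  refine sum_congr rfl fun m _ => ?_
  rw [binomPMF, nsmul_eq_mul]
  ring

theorem sum_link_sum_link (N : ℕ) (εR εD : I) (f : ℕ → ℕ → ℕ → ℝ) :
    ∑ b, (link N εR b).toReal * ∑ a, (link N εD a).toReal *
        f #(deliveredFinset b) #(deliveredFinset a) #(deliveredFinset a ∩ deliveredFinset b) =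
      ∑ m ∈ range (N + 1), ∑ mD ∈ range (N + 1), ∑ mRD ∈ Icc (m + mD - N) (min m mD),
        alpha m mD mRD N εR εD * f m mD mRD := by
  let w (m : ℕ) : ℝ := (1 - (εD : ℝ)) ^ m * (εD : ℝ) ^ (N - m)
  have sum_direct (B : Finset (Fin N)) : ∑ a, (link N εD a).toReal *
      f #B #(deliveredFinset a) #(deliveredFinset a ∩ B) =
      ∑ mD ∈ range (N + 1), ∑ mRD ∈ Icc (#B + mD - N) (min #B mD),
        (((#B).choose mRD : ℝ) * (N - #B).choose (mD - mRD)) * (w mD * f #B mD mRD) := by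
    simp only [toReal_link]
    rw [(deliveredFinset_bijective N).sum_comp fun A => w #A * f #B #A #(A ∩ B),
      sum_card_inter B fun n i => w n * f #B n i, Fintype.card_fin]
    simp only [nsmul_eq_mul, Nat.cast_mul]
  simp only [sum_direct]
  rw [sum_link N εR fun m => ∑ mD ∈ range (N + 1), ∑ mRD ∈ Icc (m + mD - N) (min m mD),
    ((m.choose mRD : ℝ) * (N - m).choose (mD - mRD)) * (w mD * f m mD mRD)]
  simp only [mul_sum]
  refine sum_congr rfl fun m _ => sum_congr rfl fun mD _ => sum_congr rfl fun mRD hmRD => ?_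
  have choose_mul_choose : (N.choose m : ℝ) * m.choose mRD =
      N.choose mRD * (N - mRD).choose (m - mRD) := by
    exact_mod_cast Nat.choose_mul ((mem_Icc.1 hmRD).2.trans (min_le_left _ _))
  rw [alpha, ← choose_mul_choose, binomPMF]
  ring

end Law

section SingleRelay

variable {F : Type*} [Field F] [Fintype F]

theorem decodingProb_one_eq_sum_link (K NS NR : ℕ) (εSD : I) (εSR εRD : Fin 1 → I) :
    decodingProb F 1 K NS NR εSD εSR εRD =
      ∑ b, (link NS (εSR 0) b).toReal * ∑ a, (link NS εSD a).toReal *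
        ∑ d, (link NR (εRD 0) d).toReal * probTwo (Fintype.card F)
          (#(deliveredFinset d) + #(deliveredFinset a))
          (#(deliveredFinset b) - #(deliveredFinset a ∩ deliveredFinset b) + #(deliveredFinset a))
          #(deliveredFinset a) K := by
  rw [decodingProb_eq_sum_uniformProb]
  simp only [uniformProb_rank_destMatrix_eq, Fin.prod_univ_one, card_delivered,
    deliveredFinset_innovative, card_sdiff]
  exact Fintype.sum_equiv (Equiv.funUnique (Fin 1) _) _ _ fun b => congrArg _ <|
    sum_congr rfl fun a _ => congrArg _ <|
      Fintype.sum_equiv (Equiv.funUnique (Fin 1) _) _ _ fun d => rfl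

theorem decodingProb_one_eq_sum (K NS NR : ℕ) (εSD : I) (εSR εRD : Fin 1 → I) :
    decodingProb F 1 K NS NR εSD εSR εRD =
      ∑ m ∈ range (NS + 1), ∑ mD ∈ range (NS + 1), ∑ mRD ∈ Icc (m + mD - NS) (min m mD),
        alpha m mD mRD NS (εSR 0) εSD * ∑ m' ∈ range (NR + 1), binomPMF m' NR (εRD 0) *
          probTwo (Fintype.card F) (m' + mD) (m - mRD + mD) mD K := by
  rw [decodingProb_one_eq_sum_link, ← sum_link_sum_link NS (εSR 0) εSD fun m mD mRD =>
    ∑ m' ∈ range (NR + 1), binomPMF m' NR (εRD 0) *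
      probTwo (Fintype.card F) (m' + mD) (m - mRD + mD) mD K]
  exact sum_congr rfl fun b _ => congrArg _ <| sum_congr rfl fun a _ => congrArg _ <|
    sum_link NR (εRD 0) fun m' => probTwo (Fintype.card F) (m' + #(deliveredFinset a))
      (#(deliveredFinset b) - #(deliveredFinset a ∩ deliveredFinset b) + #(deliveredFinset a))
      #(deliveredFinset a) K

theorem sumStageOne_eq_sum {K NS : ℕ} {f : ℕ → ℕ → ℕ → ℝ}
    (hf : ∀ m mD mRD, m + mD < K → f m mD mRD = 0) :
    sumStageOne K NS f = ∑ m ∈ range (NS + 1), ∑ mD ∈ range (NS + 1),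
      ∑ mRD ∈ Icc (m + mD - NS) (min m mD), f m mD mRD := by
  refine sum_congr rfl fun m _ => sum_filter_of_ne fun mD _ hne => ?_
  by_contra! h
  exact hne (sum_eq_zero fun mRD _ => hf m mD mRD h)

theorem decodingProb_one_eq_singleRelaySum (K NS NR : ℕ) (εSD : I) (εSR εRD : Fin 1 → I) :
    decodingProb F 1 K NS NR εSD εSR εRD =
      singleRelaySum (Fintype.card F) K NS NR εSD (εSR 0) (εRD 0) := by
  have sum_relay_eq (m mD mRD : ℕ) :
      ∑ m' ∈ range (NR + 1) with K ≤ mD + m', binomPMF m' NR (εRD 0) *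
          probTwo (Fintype.card F) (m' + mD) (m - mRD + mD) mD K =
        ∑ m' ∈ range (NR + 1), binomPMF m' NR (εRD 0) *
          probTwo (Fintype.card F) (m' + mD) (m - mRD + mD) mD K := by
    refine sum_filter_of_ne fun m' _ hne => ?_
    by_contra! h
    exact hne (by rw [probTwo_eq_zero (by omega), mul_zero])
  rw [decodingProb_one_eq_sum, singleRelaySum, sumStageOne_eq_sum]
  · simp only [sum_relay_eq]
  · intro m mD mRD h
    refine mul_eq_zero_of_right _ (sum_eq_zero fun m' _ => ?_)
    rw [probTwo_eq_zero (by omega), mul_zero]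

theorem relayBound_one (q K NS NR : ℕ) (εSD : ℝ) (εSR εRD : Fin 1 → ℝ) :
    relayBound q 1 K NS NR εSD εSR εRD = singleRelaySum q K NS NR εSD (εSR 0) (εRD 0) := by
  simp only [relayBound, singleRelaySum, Fin.prod_univ_one, Fin.sum_univ_one]
  congr with m mD mRD
  exact congrArg _ (sum_equiv (Equiv.funUnique (Fin 1) ℕ) (by simp) fun _ _ => rfl)

end SingleRelay

end RelayRLNC

theorem mainTheorem4 (F : Type*) [Field F] [Fintype F] (K NS NR : ℕ)
    (εSD : unitInterval) (εSR εRD : Fin 1 → unitInterval) :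
    RelayRLNC.decodingProb F 1 K NS NR εSD εSR εRD =
        RelayRLNC.relayBound (Fintype.card F) 1 K NS NR (εSD : ℝ)
          (fun j => (εSR j : ℝ)) (fun j => (εRD j : ℝ)) ∧
      RelayRLNC.decodingProb F 1 K NS NR εSD εSR εRD =
        RelayRLNC.singleRelaySum (Fintype.card F) K NS NR (εSD : ℝ) (εSR 0 : ℝ) (εRD 0 : ℝ) := by
  rw [RelayRLNC.relayBound_one, and_self]
  exact RelayRLNC.decodingProb_one_eq_singleRelaySum K NS NR εSD εSR εRD
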